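/- Let $\mathbb T=\{z\in\mathbb C:|z|=1\}$ with its Borel $\sigma$-algebra $\mathcal B(\mathbb T)$ and normalized Haar measure $\mu$, and let $(U(a)f)(z)=f(az)$ and $e_n(z)=z^n$ ($a\in\mathbb T$, $n\in\mathbb Z$) on $L_2(\mathbb T,\mu)$. A normalized positive operator measure on a Hilbert space $\mathcal K$ is a map $E:\mathcal B(\mathbb T)\to\mathcal L(\mathcal K)$ with $E(X)\ge 0$, $E(\mathbb T)=I$, that is $\sigma$-additive in the weak operator topology. A $\mathbb T$-covariant localization observable is such a measure on $L_2(\mathbb T,\mu)$ with $U(a)E(X)U(a)^*=E(aX)$ for all $a\in\mathbb T$, $X\in\mathcal B(\mathbb T)$. Let $\mathcal H$ be a complex Hilbert space with an orthonormal basis $(|n\rangle)_{n\in\mathbb N}$, $0\in\mathbb N$, and let $U^N(a)=\sum_{n\in\mathbb N}a^n|n\rangle\langle n|$. A phase observable is a normalized positive operator measure $\widetilde E$ on $\mathcal H$ with $U^N(a)\widetilde E(X)U^N(a)^*=\widetilde E(aX)$ for all $a\in\mathbb T$, $X\in\mathcal B(\mathbb T)$. Let $T:\mathcal H\to L_2(\mathbb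 T,\mu)$ be the linear isometry with $T|n\rangle=e_n$ for all $n\in\mathbb N$. Inner products are linear in the second argument. (1) A map $\widetilde E:\mathcal B(\mathbb T)\to\mathcal L(\mathcal H)$ is a phase observable if and only if $\widetilde E(X)=T^*E(X)T$ for all $X\in\mathcal B(\mathbb T)$, for some $\mathbb T$-covariant localization observable $E$. (2) Equivalently, a map $\widetilde E:\mathcal B(\mathbb T)\to\mathcal L(\mathcal H)$ is a phase observable if and only if there is a sequence $(\xi_n)_{n\in\mathbb N}$ of unit vectors of $\mathcal H$ generating it, that is, $$\widetilde E(X)=\sum_{n,m\in\mathbb N}\langle\xi_n|\xi_m\rangle\int_X z^{n-m}\,d\mu(z)\,|n\rangle\langle m|,\qquad X\in\mathcal B(\mathbb T),$$ where the double series (the limit of its rectangular partial sums) converges in the weak operator topology. Every sequence of unit vectors of $\mathcal H$ generates a phase observable. (3) Two sequences $(\xi_n)$, $(\eta_n)$ of unit vectors of $\mathcal H$ generate the same phase observable if and only if $\langle\xi_n|\xi_m\rangle=\langle\eta_n|\eta_m\rangle$ for all $n,m\in\mathbb N$. (4) Let $\widetilde E,\widetilde E'$ be phase observables generated by the sequences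 of unit vectors $(\xi_n)$, $(\xi'_n)$. There is a unitary $W$ on $\mathcal H$ with $WU^N(a)=U^N(a)W$ and $W\widetilde E(X)=\widetilde E'(X)W$ for all $a\in\mathbb T$, $X\in\mathcal B(\mathbb T)$ if and only if there is a sequence $(z_n)_{n\in\mathbb N}$ in $\mathbb T$ with $\langle\xi'_n|\xi'_m\rangle=\langle z_n\xi_n|z_m\xi_m\rangle$ for all $n,m\in\mathbb N$. (5) $T$ is not surjective, and there is no phase observable $\widetilde E$ that is projection valued, i.e. satisfies $\widetilde E(X)^2=\widetilde E(X)$ for all $X\in\mathcal B(\mathbb T)$. -/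

import Mathlib

open MeasureTheory Filter Topology

noncomputable section

namespace CovariantPhase

/-! ## The torus, its normalized Haar measure, and `L²` -/

/-- The Borel `σ`-algebra of the torus `𝕋 = {z ∈ ℂ : |z| = 1}`. -/
instance instMeasurableSpaceCircle : MeasurableSpace Circle := borel Circle

instance instBorelSpaceCircle : BorelSpace Circle := ⟨rfl⟩

/-- The Haar measure of the torus, normalized to total mass one. -/
def torusHaar : Measure Circle := Measure.haarMeasure ⊤

instance instIsHaarMeasureTorusHaar : torusHaar.IsHaarMeasure := by
  unfold torusHaar; infer_instance

instance instIsProbabilityMeasureTorusHaar : IsProbabilityMeasure torusHaar :=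
  ⟨by
    have h := Measure.haarMeasure_self (K₀ := (⊤ : TopologicalSpace.PositiveCompacts Circle))
    simpa [torusHaar] using h⟩

/-- The Hilbert space `L²(𝕋, μ)`. -/
abbrev L2Torus : Type := Lp ℂ 2 torusHaar

/-- The geometric action `[U(a) f](z) = f(a z)` of the torus on `L²(𝕋, μ)`. -/
def torusShift (a : Circle) : L2Torus →L[ℂ] L2Torus :=
  (Lp.compMeasurePreservingₗᵢ ℂ (fun z : Circle => a * z)
    (measurePreserving_mul_left torusHaar a)).toContinuousLinearMap

/-- The monomial `z ↦ z ^ n` as a continuous function on the torus. -/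
def monomialMap (n : ℤ) : C(Circle, ℂ) :=
  ⟨fun z => ((z ^ n : Circle) : ℂ), continuous_subtype_val.comp (continuous_zpow n)⟩

/-- The monomial `e_n(z) = z ^ n` as an element of `L²(𝕋, μ)`. -/
def monomialL2 (n : ℤ) : L2Torus :=
  ContinuousMap.toLp (E := ℂ) 2 torusHaar ℂ (monomialMap n)

theorem integral_zpow_eq_zero {k : ℤ} (hk : k ≠ 0) :
    ∫ z : Circle, ((z ^ k : Circle) : ℂ) ∂torusHaar = 0 := by
  have ha : (Circle.exp (Real.pi / k)) ^ k = (-1 : Circle) := by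
    have hk' : (k : ℝ) ≠ 0 := by exact_mod_cast hk
    rw [← Circle.exp_zsmul, zsmul_eq_mul, mul_div_cancel₀ _ hk']
    ext; simp
  refine integral_eq_zero_of_mul_left_eq_neg (g := Circle.exp (Real.pi / k)) fun z => ?_
  rw [mul_zpow, ha]; simp

theorem orthonormal_monomialL2 : Orthonormal ℂ monomialL2 := by
  rw [orthonormal_iff_ite]
  intro i j
  unfold monomialL2
  rw [ContinuousMap.inner_toLp]
  have h : ∀ z : Circle, monomialMap j z * (starRingEnd ℂ) (monomialMap i z)
      = ((z ^ (j - i) : Circle) : ℂ) := by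
    intro z
    simp only [monomialMap, ContinuousMap.coe_mk]
    rw [← Circle.coe_inv_eq_conj, ← Circle.coe_mul, zpow_sub]
  simp_rw [h]
  split_ifs with hij
  · simp [hij]
  · exact integral_zpow_eq_zero (sub_ne_zero.mpr (Ne.symm hij))

/-! ## Isometries prescribed on an orthonormal basis -/

section Isometry

variable {H K : Type*} [NormedAddCommGroup H] [InnerProductSpace ℂ H]
  [NormedAddCommGroup K] [InnerProductSpace ℂ K] [CompleteSpace K]

/-- The linear isometry sending the orthonormal basis `b` to the orthonormal sequence `v`. -/
def basisIsometry (b : HilbertBasis ℕ ℂ H) {v : ℕ → K} (hv : Orthonormal ℂ v) : H →ₗᵢ[ℂ] K :=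
  hv.orthogonalFamily.linearIsometry.comp b.repr.toLinearIsometry

theorem basisIsometry_apply_basis (b : HilbertBasis ℕ ℂ H) {v : ℕ → K} (hv : Orthonormal ℂ v)
    (n : ℕ) : basisIsometry b hv (b n) = v n := by
  classical
  change hv.orthogonalFamily.linearIsometry (b.repr (b n)) = v n
  rw [HilbertBasis.repr_self, OrthogonalFamily.linearIsometry_apply_single]
  simp

end Isometry

section Number

variable {H : Type*} [NormedAddCommGroup H] [InnerProductSpace ℂ H]

theorem orthonormal_phase_smul (b : HilbertBasis ℕ ℂ H) (a : Circle) :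
    Orthonormal ℂ (fun n : ℕ => ((a ^ n : Circle) : ℂ) • b n) := by
  rw [orthonormal_iff_ite]
  intro i j
  rw [inner_smul_left, inner_smul_right, orthonormal_iff_ite.mp b.orthonormal i j]
  split_ifs with h
  · subst h
    rw [mul_one, ← Circle.coe_inv_eq_conj, ← Circle.coe_mul]
    simp
  · simp

/-- The phase shifter `U^N(a) = ∑ₙ aⁿ |n⟩⟨n|` of the number basis `b n = |n⟩`. -/
def numberShift [CompleteSpace H] (b : HilbertBasis ℕ ℂ H) (a : Circle) : H →L[ℂ] H :=
  (basisIsometry b (orthonormal_phase_smul b a)).toContinuousLinearMap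

theorem hasSum_numberShift [CompleteSpace H] (b : HilbertBasis ℕ ℂ H) (a : Circle) (ψ : H) :
    HasSum (fun n : ℕ => (((a ^ n : Circle) : ℂ) • InnerProductSpace.rankOne ℂ (b n) (b n)) ψ)
      (numberShift b a ψ) := by
  convert! (b.hasSum_repr ψ).mapL (numberShift b a) using 2 with n
  have h : numberShift b a (b n) = ((a ^ n : Circle) : ℂ) • b n :=
    basisIsometry_apply_basis b (orthonormal_phase_smul b a) n
  rw [map_smul, h, smul_apply, InnerProductSpace.rankOne_apply,
    HilbertBasis.repr_apply_apply, smul_comm]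

/-- The linear isometry `T : H → L²(𝕋, μ)` with `T|n⟩ = e_n` for all `n ∈ ℕ`. -/
def numberToTorus (b : HilbertBasis ℕ ℂ H) : H →L[ℂ] L2Torus :=
  (basisIsometry b (orthonormal_monomialL2.comp (fun n : ℕ => (n : ℤ))
    Nat.cast_injective)).toContinuousLinearMap

theorem numberToTorus_basis (b : HilbertBasis ℕ ℂ H) (n : ℕ) :
    numberToTorus b (b n) = monomialL2 (n : ℤ) :=
  basisIsometry_apply_basis b (orthonormal_monomialL2.comp (fun n : ℕ => (n : ℤ))
    Nat.cast_injective) n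

end Number

/-! ## Operator measures on the torus and covariance

An operator-valued set function is given on all subsets of the torus; only its values on Borel
sets matter, and every notion below refers to Borel sets only. -/

section Observables

variable {K : Type*} [NormedAddCommGroup K] [InnerProductSpace ℂ K] [CompleteSpace K]

/-- `E` is a normalized positive operator measure on the Borel sets of the torus:
`E(X) ≥ 0`, `E(𝕋) = I`, and `E` is `σ`-additive in the weak operator topology. -/
structure IsNormalizedPOM (E : Set Circle → K →L[ℂ] K) : Prop where
  positive : ∀ X, MeasurableSet X → (E X).IsPositive
  normalized : E Set.univ = 1
  sigma_additive : ∀ f : ℕ → Set Circle, (∀ i, MeasurableSet (f i)) →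
    Pairwise (fun i j => Disjoint (f i) (f j)) →
    HasSum (fun i => ContinuousLinearMapWOT.ofCLM (E (f i)))
      (ContinuousLinearMapWOT.ofCLM (E (⋃ i, f i)))

/-- A normalized positive operator measure with `U(a) E(X) U(a)* = E(aX)`. -/
structure IsCovariantObservable (U : Circle → K →L[ℂ] K) (E : Set Circle → K →L[ℂ] K) : Prop where
  isNormalizedPOM : IsNormalizedPOM E
  covariant : ∀ (a : Circle) (X : Set Circle), MeasurableSet X →
    U a ∘L E X ∘L (U a).adjoint = E ((fun z => a * z) '' X)

/-- Equality of two operator measures on the Borel sets. -/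
def SameObservable (E E' : Set Circle → K →L[ℂ] K) : Prop :=
  ∀ X, MeasurableSet X → E X = E' X

/-- Equivalence of the covariance systems `(U, E)` and `(U, E')`: some unitary `W` satisfies
`W U(a) = U(a) W` and `W E(X) = E'(X) W`. -/
def EquivalentObservables (U : Circle → K →L[ℂ] K) (E E' : Set Circle → K →L[ℂ] K) : Prop :=
  ∃ W : K ≃ₗᵢ[ℂ] K,
    (∀ (a : Circle) (φ : K), W (U a φ) = U a (W φ)) ∧
    (∀ X : Set Circle, MeasurableSet X → ∀ φ : K, W (E X φ) = E' X (W φ))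

/-- `E` is projection valued. -/
def IsProjectionValued (E : Set Circle → K →L[ℂ] K) : Prop :=
  ∀ X, MeasurableSet X → E X * E X = E X

end Observables

/-- A `𝕋`-covariant localization observable on `L²(𝕋, μ)`. -/
def IsLocalizationObservable (E : Set Circle → L2Torus →L[ℂ] L2Torus) : Prop :=
  IsCovariantObservable torusShift E

section Phase

variable {H : Type*} [NormedAddCommGroup H] [InnerProductSpace ℂ H] [CompleteSpace H]

/-- A phase observable, relative to the number basis `b`. -/
def IsPhaseObservable (b : HilbertBasis ℕ ℂ H) (E : Set Circle → H →L[ℂ] H) : Prop :=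
  IsCovariantObservable (numberShift b) E

/-- `E(X) = ∑_{n,m ∈ ℕ} ⟨ξ_n|ξ_m⟩ ∫_X z^{n-m} dμ(z) |n⟩⟨m|` for every Borel set `X`, the double
series (limit of its rectangular partial sums) converging in the weak operator topology. -/
def IsGeneratedBy (b : HilbertBasis ℕ ℂ H) (ξ : ℕ → H) (E : Set Circle → H →L[ℂ] H) : Prop :=
  ∀ X, MeasurableSet X →
    Tendsto (fun p : ℕ × ℕ => ContinuousLinearMapWOT.ofCLM
        (∑ n ∈ Finset.range p.1, ∑ m ∈ Finset.range p.2,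
          (inner ℂ (ξ n) (ξ m) * ∫ z in X, (z : ℂ) ^ ((n : ℤ) - (m : ℤ)) ∂torusHaar) •
            InnerProductSpace.rankOne ℂ (b n) (b m)))
      atTop (𝓝 (ContinuousLinearMapWOT.ofCLM (E X)))

end Phase

end CovariantPhase

end

/-! Everything is read off the matrix elements `⟨n|F(X)m⟩`. Covariance makes `a ^ (-(n-m))
⟨n|F(aX)m⟩` independent of `a`; averaging over Haar measure and using Fubini gives `⟨n|F(X)m⟩ = c n
m ∫_X z ^ (n-m) dμ` (`IsCovariantObservable.exists_hasPhaseMatrix`). An observable is thus a scalar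
matrix `c`. Since each character has a nonzero integral over some Borel set, `c` is unique.

Positivity on all Borel sets makes the trigonometric polynomials `∑ conj (x n) x m c n m z ^ (n-m)`
nonnegative everywhere; their value at `z = 1` shows that `c` is positive semidefinite, and
normalization gives `c n n = 1`. Such a matrix is the Gram matrix of unit vectors of `H`
(`exists_gram_of_posSemidef`). Conversely, for unit vectors `ξ n`, the map `|n⟩ ↦ z ^ (-n) ξ n` is
an isometry into `L²(𝕋; H)`, and compressing multiplication by `χ_X` along it realizes the Gram
matrix (`exists_hasPhaseMatrix_gram`).

The same construction over `ℤ` yields a localization observable whose `ℕ`-block is a given phase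
observable. A unitary commuting with `U^N` is diagonal with phases, so equivalence only rephases the
`ξ n`. Projection valuedness would make the Fourier coefficients of `χ_X` with one sign of the
index, together with the constant one, exhaust Bessel's inequality, which fails if the coefficient
of opposite index `-1` is nonzero. -/

noncomputable section

namespace CovariantPhase

/-! ## Trigonometric moments of Borel sets -/

/-- The trigonometric moment `∫_X z ^ k dμ`. -/
def moment (X : Set Circle) (k : ℤ) : ℂ := ∫ z in X, (z : ℂ) ^ k ∂torusHaar

theorem continuous_coe_zpow (k : ℤ) : Continuous fun z : Circle => (z : ℂ) ^ k := by
  simpa [monomialMap] using (monomialMap k).continuous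

theorem integrable_coe_zpow (k : ℤ) (ρ : Measure Circle) [IsFiniteMeasure ρ] :
    Integrable (fun z : Circle => (z : ℂ) ^ k) ρ :=
  Integrable.of_bound (continuous_coe_zpow k).aestronglyMeasurable 1
    (ae_of_all _ fun z => by rw [norm_zpow, Circle.norm_coe, one_zpow])

theorem measurableSet_image_mul_left (a : Circle) {X : Set Circle} (hX : MeasurableSet X) :
    MeasurableSet ((fun z => a * z) '' X) :=
  (MeasurableEquiv.mulLeft a).measurableSet_image.mpr hX

theorem moment_image (a : Circle) (X : Set Circle) (k : ℤ) :
    moment ((fun z => a * z) '' X) k = (a : ℂ) ^ k * moment X k := by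
  unfold moment
  rw [(measurePreserving_mul_left torusHaar a).setIntegral_image_emb
    (measurableEmbedding_mulLeft a)]
  rw [← integral_const_mul]
  simp [mul_zpow]

theorem moment_univ (k : ℤ) : moment Set.univ k = if k = 0 then 1 else 0 := by
  unfold moment
  split_ifs with h
  · simp [h]
  · simpa using integral_zpow_eq_zero h

theorem moment_zero (X : Set Circle) : moment X 0 = (torusHaar.real X : ℂ) := by
  simp [moment]

theorem conj_moment (X : Set Circle) (k : ℤ) :
    (starRingEnd ℂ) (moment X k) = moment X (-k) := by
  unfold moment
  rw [← integral_conj]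
  congr 1
  ext z
  rw [map_zpow₀, ← Circle.coe_inv_eq_conj, Circle.coe_inv, inv_zpow, zpow_neg]

/-- A function with vanishing integral over every Borel set is zero almost everywhere, whereas `z ^
k` has modulus one. This allows moments to be cancelled from matrix identities, with a set depending
on `k`. -/
theorem exists_moment_ne_zero (k : ℤ) : ∃ X, MeasurableSet X ∧ moment X k ≠ 0 := by
  by_contra! h
  have h0 := Integrable.ae_eq_zero_of_forall_setIntegral_eq_zero
    (integrable_coe_zpow k torusHaar) (fun s hs _ => h s hs)
  have : ∀ᵐ z : Circle ∂torusHaar, False := by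
    filter_upwards [h0] with z hz
    exact zpow_ne_zero k (Circle.coe_ne_zero z) hz
  simp [ae_iff] at this

theorem exists_circle_zpow_ne_one {k : ℤ} (hk : k ≠ 0) : ∃ a : Circle, a ^ k ≠ 1 := by
  by_contra! h
  have h1 : ∀ z : Circle, ((z ^ k : Circle) : ℂ) = 1 := fun z => by simp [h z]
  have := integral_zpow_eq_zero hk
  simp only [h1] at this
  simp at this

/-! ## Operators and their matrix elements -/

section Matrix

variable {ι H : Type*} [NormedAddCommGroup H] [InnerProductSpace ℂ H]

theorem ext_inner_basis (b : HilbertBasis ι ℂ H) {φ ψ : H}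
    (h : ∀ n, inner ℂ (b n) φ = inner ℂ (b n) ψ) : φ = ψ := by
  apply b.repr.injective
  ext n
  simpa [HilbertBasis.repr_apply_apply] using h n

theorem clm_ext_basis {K : Type*} [NormedAddCommGroup K] [InnerProductSpace ℂ K]
    (b : HilbertBasis ι ℂ H) {A B : H →L[ℂ] K} (h : ∀ n, A (b n) = B (b n)) : A = B := by
  apply ContinuousLinearMap.ext_on (s := Set.range b)
  · rw [Submodule.dense_iff_topologicalClosure_eq_top]
    exact b.dense_span
  · rintro _ ⟨n, rfl⟩
    exact h n

theorem clm_ext_matrix (b : HilbertBasis ι ℂ H) {A B : H →L[ℂ] H}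
    (h : ∀ n m, inner ℂ (b n) (A (b m)) = inner ℂ (b n) (B (b m))) : A = B :=
  clm_ext_basis b fun m => ext_inner_basis b fun n => h n m

/-- The matrix elements of `F(X)` in the basis `b` are `c n m ∫_X z ^ (d n - d m) dμ`. -/
def HasPhaseMatrix (d : ι → ℤ) (b : HilbertBasis ι ℂ H) (c : ι → ι → ℂ)
    (F : Set Circle → H →L[ℂ] H) : Prop :=
  ∀ X, MeasurableSet X → ∀ n m, inner ℂ (b n) (F X (b m)) = c n m * moment X (d n - d m)

theorem HasPhaseMatrix.sameObservable_iff {d : ι → ℤ} {b : HilbertBasis ι ℂ H}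
    {c c' : ι → ι → ℂ} {F F' : Set Circle → H →L[ℂ] H} (hF : HasPhaseMatrix d b c F)
    (hF' : HasPhaseMatrix d b c' F') : SameObservable F F' ↔ ∀ n m, c n m = c' n m := by
  constructor
  · intro h n m
    obtain ⟨X, hX, h0⟩ := exists_moment_ne_zero (d n - d m)
    have h1 := hF X hX n m
    rw [h X hX, hF' X hX] at h1
    exact (mul_right_cancel₀ h0 h1).symm
  · intro h X hX
    refine clm_ext_matrix b fun n m => ?_
    rw [hF X hX, hF' X hX, h]

variable [CompleteSpace H]

/-- Reduces weak operator `σ`-additivity to countable additivity of scalar set functions. -/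
theorem hasSum_ofCLM_iff {α : Type*} (A : α → H →L[ℂ] H) (B : H →L[ℂ] H) :
    HasSum (fun i => ContinuousLinearMapWOT.ofCLM (A i)) (ContinuousLinearMapWOT.ofCLM B) ↔
      ∀ φ ψ, HasSum (fun i => inner ℂ φ (A i ψ)) (inner ℂ φ (B ψ)) := by
  classical
  have key : ∀ (s : Finset α) (φ ψ : H),
      inner ℂ φ ((∑ i ∈ s, ContinuousLinearMapWOT.ofCLM (A i)) ψ)
        = ∑ i ∈ s, inner ℂ φ (A i ψ) := by
    intro s φ ψ
    induction s using Finset.induction_on with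
    | empty => simp
    | insert a s ha ih =>
      rw [Finset.sum_insert ha, Finset.sum_insert ha, ContinuousLinearMapWOT.add_apply,
        inner_add_right, ih, ContinuousLinearMapWOT.coe_ofCLM]
  unfold HasSum
  rw [ContinuousLinearMapWOT.tendsto_iff_forall_inner_apply_tendsto]
  simp only [key, ContinuousLinearMapWOT.coe_ofCLM]
  exact forall_comm

/-- `U` acts diagonally in the basis `b`, with character `d n` on the vector `b n`. -/
def IsDiagonalAction (d : ι → ℤ) (b : HilbertBasis ι ℂ H) (U : Circle → H →L[ℂ] H) : Prop :=
  ∀ a n, U a (b n) = (a : ℂ) ^ d n • b n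

theorem IsDiagonalAction.adjoint_apply {d : ι → ℤ} {b : HilbertBasis ι ℂ H}
    {U : Circle → H →L[ℂ] H} (hU : IsDiagonalAction d b U) (a : Circle) (n : ι) :
    (U a).adjoint (b n) = (a : ℂ) ^ (-d n) • b n := by
  classical
  refine ext_inner_basis b fun m => ?_
  rw [ContinuousLinearMap.adjoint_inner_right, hU, inner_smul_left, inner_smul_right,
    orthonormal_iff_ite.mp b.orthonormal]
  split_ifs with h
  · subst h
    rw [map_zpow₀, ← Circle.coe_inv_eq_conj, Circle.coe_inv, inv_zpow, zpow_neg]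
  · simp

theorem IsDiagonalAction.covariant_iff {d : ι → ℤ} {b : HilbertBasis ι ℂ H}
    {U : Circle → H →L[ℂ] H} (hU : IsDiagonalAction d b U) (a : Circle) (A B : H →L[ℂ] H) :
    U a ∘L A ∘L (U a).adjoint = B ↔
      ∀ n m, inner ℂ (b n) (B (b m)) = (a : ℂ) ^ (d n - d m) * inner ℂ (b n) (A (b m)) := by
  have key : ∀ n m, inner ℂ (b n) ((U a ∘L A ∘L (U a).adjoint) (b m))
      = (a : ℂ) ^ (d n - d m) * inner ℂ (b n) (A (b m)) := by
    intro n m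
    rw [ContinuousLinearMap.comp_apply, ContinuousLinearMap.comp_apply,
      ← ContinuousLinearMap.adjoint_inner_left, hU.adjoint_apply, hU.adjoint_apply,
      map_smul, inner_smul_left, inner_smul_right, map_zpow₀, ← Circle.coe_inv_eq_conj,
      Circle.coe_inv, inv_zpow, zpow_neg, inv_inv, ← mul_assoc,
      sub_eq_add_neg, zpow_add₀ (Circle.coe_ne_zero a)]
  constructor
  · rintro rfl
    exact key
  · intro h
    refine clm_ext_matrix b fun n m => ?_
    rw [key, h]

theorem HasPhaseMatrix.isCovariantObservable {d : ι → ℤ} {b : HilbertBasis ι ℂ H}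
    {U : Circle → H →L[ℂ] H} (hU : IsDiagonalAction d b U) {c : ι → ι → ℂ}
    {F : Set Circle → H →L[ℂ] H} (hF : HasPhaseMatrix d b c F) (hP : IsNormalizedPOM F) :
    IsCovariantObservable U F := by
  refine ⟨hP, fun a X hX => (hU.covariant_iff a _ _).mpr fun n m => ?_⟩
  rw [hF _ (measurableSet_image_mul_left a hX), hF _ hX, moment_image]
  ring

/-- Matrix data determine a set function on Borel sets only, so being an observable has to be
transported along agreement there. -/
theorem IsCovariantObservable.congr {U : Circle → H →L[ℂ] H} {F F' : Set Circle → H →L[ℂ] H}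
    (hF : IsCovariantObservable U F) (h : SameObservable F' F) : IsCovariantObservable U F' := by
  refine ⟨⟨fun X hX => ?_, ?_, fun f hf hd => ?_⟩, fun a X hX => ?_⟩
  · rw [h X hX]; exact hF.1.positive X hX
  · rw [h _ .univ]; exact hF.1.normalized
  · simp_rw [h _ (hf _), h _ (MeasurableSet.iUnion hf)]
    exact hF.1.sigma_additive f hf hd
  · rw [h X hX, h _ (measurableSet_image_mul_left a hX)]
    exact hF.covariant a X hX

end Matrix

/-! ## Observables built from unit vectors -/

section Construction

variable {ι H K : Type*} [NormedAddCommGroup H] [InnerProductSpace ℂ H]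
  [NormedAddCommGroup K] [InnerProductSpace ℂ K]

/-- The vector-valued character `z ↦ z ^ k ξ`. -/
def vectorCharacter (k : ℤ) (ξ : K) : C(Circle, K) :=
  ⟨fun z => (z : ℂ) ^ k • ξ, (continuous_coe_zpow k).smul continuous_const⟩

/-- The vector-valued character `z ↦ z ^ k ξ` as an element of `L²(𝕋, μ; K)`. -/
def vectorCharacterL2 (k : ℤ) (ξ : K) : Lp K 2 torusHaar :=
  ContinuousMap.toLp (E := K) 2 torusHaar ℂ (vectorCharacter k ξ)

theorem inner_restrict_L2 (X : Set Circle) (f g : Lp K 2 torusHaar) :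
    inner ℂ (LpToLpRestrictCLM Circle K ℂ torusHaar 2 X f)
      (LpToLpRestrictCLM Circle K ℂ torusHaar 2 X g) = ∫ z in X, inner ℂ (f z) (g z) ∂torusHaar := by
  rw [L2.inner_def]
  refine integral_congr_ae ?_
  filter_upwards [LpToLpRestrictCLM_coeFn ℂ X f, LpToLpRestrictCLM_coeFn ℂ X g] with z h1 h2
  rw [h1, h2]

theorem setIntegral_inner_vectorCharacterL2 (X : Set Circle) (k l : ℤ) (ξ η : K) :
    ∫ z in X, inner ℂ (vectorCharacterL2 k ξ z) (vectorCharacterL2 l η z) ∂torusHaar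
      = inner ℂ ξ η * moment X (l - k) := by
  unfold moment
  rw [← integral_const_mul]
  refine integral_congr_ae (ae_restrict_of_ae ?_)
  filter_upwards [ContinuousMap.coeFn_toLp (E := K) (p := 2) (𝕜 := ℂ) torusHaar
      (vectorCharacter k ξ),
    ContinuousMap.coeFn_toLp (E := K) (p := 2) (𝕜 := ℂ) torusHaar (vectorCharacter l η)]
    with z h1 h2
  rw [vectorCharacterL2, vectorCharacterL2, h1, h2]
  simp only [vectorCharacter, ContinuousMap.coe_mk]
  rw [inner_smul_left, inner_smul_right, map_zpow₀, ← Circle.coe_inv_eq_conj, Circle.coe_inv,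
    inv_zpow, ← zpow_neg, sub_eq_add_neg, zpow_add₀ (Circle.coe_ne_zero z)]
  ring

/-- Distinct characters are orthogonal whatever vectors multiply them, so no relation among the `ξ
n` is needed. The exponent is `-d n` because the inner product conjugates its first argument, which
leaves `z ^ (d n - d m)`. -/
theorem orthonormal_vectorCharacterL2 {d : ι → ℤ} (hd : Function.Injective d) {ξ : ι → K}
    (hξ : ∀ n, ‖ξ n‖ = 1) : Orthonormal ℂ fun n => vectorCharacterL2 (-d n) (ξ n) := by
  classical
  rw [orthonormal_iff_ite]
  intro i j
  rw [L2.inner_def, ← setIntegral_univ, setIntegral_inner_vectorCharacterL2, moment_univ]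
  by_cases h : i = j
  · subst h
    simp [inner_self_eq_norm_sq_to_K, hξ]
  · have : -d j - -d i ≠ 0 := fun h0 => h (hd (by omega))
    simp only [this, h, if_false, mul_zero]

variable [CompleteSpace K]

/-- The linear isometry sending the orthonormal basis `b` to the orthonormal family `v`. -/
def orthonormalLift (b : HilbertBasis ι ℂ H) {v : ι → K} (hv : Orthonormal ℂ v) : H →ₗᵢ[ℂ] K :=
  hv.orthogonalFamily.linearIsometry.comp b.repr.toLinearIsometry

theorem orthonormalLift_apply_basis (b : HilbertBasis ι ℂ H) {v : ι → K} (hv : Orthonormal ℂ v)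
    (n : ι) : orthonormalLift b hv (b n) = v n := by
  classical
  change hv.orthogonalFamily.linearIsometry (b.repr (b n)) = v n
  rw [HilbertBasis.repr_self, OrthogonalFamily.linearIsometry_apply_single]
  simp

variable [CompleteSpace H]

/-- The compression `X ↦ V* χ_X V` of the canonical spectral measure of `L²(𝕋, μ; K)`. -/
def compressedSpectralMeasure (V : H →ₗᵢ[ℂ] Lp K 2 torusHaar) (X : Set Circle) : H →L[ℂ] H :=
  (LpToLpRestrictCLM Circle K ℂ torusHaar 2 X ∘L V.toContinuousLinearMap).adjoint ∘L
    (LpToLpRestrictCLM Circle K ℂ torusHaar 2 X ∘L V.toContinuousLinearMap)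

theorem inner_compressedSpectralMeasure (V : H →ₗᵢ[ℂ] Lp K 2 torusHaar) (X : Set Circle)
    (φ ψ : H) : inner ℂ φ (compressedSpectralMeasure V X ψ)
      = ∫ z in X, inner ℂ (V φ z) (V ψ z) ∂torusHaar := by
  rw [compressedSpectralMeasure, ContinuousLinearMap.comp_apply,
    ContinuousLinearMap.adjoint_inner_right]
  exact inner_restrict_L2 X _ _

/-- Positivity comes from the form `A* A`, normalization from `V` being isometric, and
`σ`-additivity from integrating one fixed integrable function over varying sets. -/
theorem isNormalizedPOM_compressedSpectralMeasure (V : H →ₗᵢ[ℂ] Lp K 2 torusHaar) :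
    IsNormalizedPOM (compressedSpectralMeasure V) := by
  refine ⟨fun X _ => ContinuousLinearMap.isPositive_adjoint_comp_self _, ?_, fun f hf hd => ?_⟩
  · refine ContinuousLinearMap.ext fun ψ => ext_inner_left ℂ fun φ => ?_
    rw [inner_compressedSpectralMeasure, setIntegral_univ, ← L2.inner_def, V.inner_map_map]
    rfl
  · refine (hasSum_ofCLM_iff _ _).mpr fun φ ψ => ?_
    simp_rw [inner_compressedSpectralMeasure]
    exact hasSum_integral_iUnion hf hd (L2.integrable_inner (𝕜 := ℂ) (V φ) (V ψ)).integrableOn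

/-- The index type and the weights `d` are general so as to serve both the number basis (`ℕ`) and
the Fourier basis (`ℤ`). -/
theorem exists_hasPhaseMatrix_gram {d : ι → ℤ} (hd : Function.Injective d)
    (b : HilbertBasis ι ℂ H) {ξ : ι → K} (hξ : ∀ n, ‖ξ n‖ = 1) :
    ∃ F : Set Circle → H →L[ℂ] H, IsNormalizedPOM F ∧
      HasPhaseMatrix d b (fun n m => inner ℂ (ξ n) (ξ m)) F := by
  refine ⟨compressedSpectralMeasure (orthonormalLift b (orthonormal_vectorCharacterL2 hd hξ)),
    isNormalizedPOM_compressedSpectralMeasure _, fun X _ n m => ?_⟩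
  rw [inner_compressedSpectralMeasure, orthonormalLift_apply_basis, orthonormalLift_apply_basis,
    setIntegral_inner_vectorCharacterL2]
  congr 2
  ring

end Construction

/-! ## Covariant observables have phase matrices -/

section Converse

/-- Fubini: averaging the translates of a finite measure against a character. -/
theorem integral_zpow_mul_measureReal_image (ρ : Measure Circle) [IsFiniteMeasure ρ]
    {X : Set Circle} (hX : MeasurableSet X) (k : ℤ) :
    ∫ a : Circle, (a : ℂ) ^ (-k) * (ρ.real ((fun z => a * z) '' X) : ℂ) ∂torusHaar
      = moment X k * ∫ z : Circle, (z : ℂ) ^ (-k) ∂ρ := by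
  have hind : Measurable (X.indicator fun _ : Circle => (1 : ℂ)) := measurable_const.indicator hX
  have h1 : ∀ a : Circle, (a : ℂ) ^ (-k) * (ρ.real ((fun z => a * z) '' X) : ℂ)
      = ∫ z, (a : ℂ) ^ (-k) * X.indicator (fun _ => (1 : ℂ)) (a⁻¹ * z) ∂ρ := by
    intro a
    rw [integral_const_mul]
    congr 1
    have : (fun z => X.indicator (fun _ => (1 : ℂ)) (a⁻¹ * z))
        = ((fun z => a * z) '' X).indicator fun _ => (1 : ℂ) := by
      ext z
      have : z ∈ (fun z => a * z) '' X ↔ a⁻¹ * z ∈ X := by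
        rw [Set.image_mul_left]; rfl
      by_cases h : a⁻¹ * z ∈ X
      · rw [Set.indicator_of_mem h, Set.indicator_of_mem (this.mpr h)]
      · rw [Set.indicator_of_notMem h, Set.indicator_of_notMem (mt this.mp h)]
    rw [this, integral_indicator (measurableSet_image_mul_left a hX)]
    simp
  have h2 : ∀ z : Circle, ∫ a : Circle, (a : ℂ) ^ (-k) * X.indicator (fun _ => (1 : ℂ)) (a⁻¹ * z)
      ∂torusHaar = moment X k * (z : ℂ) ^ (-k) := by
    intro z
    -- The substitution `a ↦ z / a` preserves Haar measure and turns the condition `a⁻¹ z ∈ X` into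
    -- `a ∈ X`.
    rw [← integral_div_left_eq_self _ torusHaar z]
    have : ∀ a : Circle, ((z / a : Circle) : ℂ) ^ (-k) *
        X.indicator (fun _ => (1 : ℂ)) ((z / a)⁻¹ * z)
        = X.indicator (fun a : Circle => (a : ℂ) ^ k) a * (z : ℂ) ^ (-k) := by
      intro a
      have : (z / a)⁻¹ * z = a := by rw [inv_div, div_mul_cancel]
      rw [this]
      by_cases h : a ∈ X
      · rw [Set.indicator_of_mem h, Set.indicator_of_mem h, Circle.coe_div, div_zpow, zpow_neg,
          zpow_neg, div_inv_eq_mul]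
        ring
      · simp [Set.indicator_of_notMem h]
    simp_rw [this]
    rw [integral_mul_const, integral_indicator hX]
    rfl
  simp_rw [h1]
  rw [integral_integral_swap]
  · simp_rw [h2]
    rw [integral_const_mul]
  · refine Integrable.of_bound (C := 1) ?_ (ae_of_all _ fun p => ?_)
    · refine Measurable.aestronglyMeasurable ?_
      refine (((continuous_coe_zpow (-k)).measurable).comp measurable_fst).mul
        (hind.comp (measurable_fst.inv.mul measurable_snd))
    · simp only [Function.uncurry]
      rw [norm_mul, norm_zpow, Circle.norm_coe, one_zpow, one_mul]
      refine (norm_indicator_le_norm_self _ _).trans ?_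
      simp

variable {ι H : Type*} [NormedAddCommGroup H] [InnerProductSpace ℂ H] [CompleteSpace H]

/-- Additivity for the constant sequence `∅` gives a summable constant series, whose terms must
vanish. -/
theorem IsNormalizedPOM.inner_empty {F : Set Circle → H →L[ℂ] H} (hF : IsNormalizedPOM F)
    (φ ψ : H) : inner ℂ φ (F ∅ ψ) = 0 := by
  have h := (hasSum_ofCLM_iff _ _).mp (hF.sigma_additive (fun _ => ∅) (fun _ => .empty)
    (fun i j _ => disjoint_bot_left)) φ ψ
  exact tendsto_nhds_unique tendsto_const_nhds h.summable.tendsto_atTop_zero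

theorem IsNormalizedPOM.hasSum_re_inner {F : Set Circle → H →L[ℂ] H} (hF : IsNormalizedPOM F)
    (φ : H) {f : ℕ → Set Circle} (hf : ∀ i, MeasurableSet (f i))
    (hd : Pairwise fun i j => Disjoint (f i) (f j)) :
    HasSum (fun i => (inner ℂ φ (F (f i) φ)).re) (inner ℂ φ (F (⋃ i, f i) φ)).re :=
  Complex.hasSum_re ((hasSum_ofCLM_iff _ _).mp (hF.sigma_additive f hf hd) φ φ)

/-- The positive measure `X ↦ ⟨φ|F(X)φ⟩`. -/
def IsNormalizedPOM.diagonalMeasure {F : Set Circle → H →L[ℂ] H} (hF : IsNormalizedPOM F)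
    (φ : H) : Measure Circle :=
  Measure.ofMeasurable (fun X _ => ENNReal.ofReal (inner ℂ φ (F X φ)).re)
    (by simp [hF.inner_empty])
    (fun f hf hd => by
      have h := hF.hasSum_re_inner φ hf hd
      rw [← h.tsum_eq]
      exact ENNReal.ofReal_tsum_of_nonneg
        (fun i => (hF.positive _ (hf i)).re_inner_nonneg_right φ) h.summable)

theorem IsNormalizedPOM.diagonalMeasure_apply {F : Set Circle → H →L[ℂ] H}
    (hF : IsNormalizedPOM F) (φ : H) {X : Set Circle} (hX : MeasurableSet X) :
    hF.diagonalMeasure φ X = ENNReal.ofReal (inner ℂ φ (F X φ)).re :=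
  Measure.ofMeasurable_apply X hX

theorem IsNormalizedPOM.isFiniteMeasure_diagonalMeasure {F : Set Circle → H →L[ℂ] H}
    (hF : IsNormalizedPOM F) (φ : H) : IsFiniteMeasure (hF.diagonalMeasure φ) :=
  ⟨by rw [hF.diagonalMeasure_apply φ .univ]; exact ENNReal.ofReal_lt_top⟩

theorem IsNormalizedPOM.diagonalMeasure_real {F : Set Circle → H →L[ℂ] H}
    (hF : IsNormalizedPOM F) (φ : H) {X : Set Circle} (hX : MeasurableSet X) :
    ((hF.diagonalMeasure φ).real X : ℂ) = inner ℂ φ (F X φ) := by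
  have hp := hF.positive X hX
  rw [Measure.real, hF.diagonalMeasure_apply φ hX,
    ENNReal.toReal_ofReal (by exact hp.re_inner_nonneg_right φ)]
  exact (RCLike.nonneg_iff_exists_ofReal.mp (hp.inner_nonneg_right φ)).elim
    fun r hr => by rw [← hr.2]; simp

/-- The point is that `c` does not depend on `X`. Integrability is carried along because
polarization needs linearity of the integral. -/
theorem IsNormalizedPOM.exists_integral_image_diagonal {F : Set Circle → H →L[ℂ] H}
    (hF : IsNormalizedPOM F) (φ : H) (k : ℤ) :
    ∃ c : ℂ, ∀ X, MeasurableSet X →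
      Integrable (fun a : Circle => (a : ℂ) ^ (-k) * inner ℂ φ (F ((fun z => a * z) '' X) φ))
        torusHaar ∧
      ∫ a : Circle, (a : ℂ) ^ (-k) * inner ℂ φ (F ((fun z => a * z) '' X) φ) ∂torusHaar
        = c * moment X k := by
  have := hF.isFiniteMeasure_diagonalMeasure φ
  refine ⟨∫ z : Circle, (z : ℂ) ^ (-k) ∂hF.diagonalMeasure φ, fun X hX => ?_⟩
  simp_rw [← hF.diagonalMeasure_real φ (measurableSet_image_mul_left _ hX)]
  refine ⟨?_, by rw [integral_zpow_mul_measureReal_image _ hX, mul_comm]⟩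
  refine Integrable.of_bound (C := (hF.diagonalMeasure φ).real Set.univ) ?_
    (ae_of_all _ fun a => ?_)
  · refine Measurable.aestronglyMeasurable ((continuous_coe_zpow (-k)).measurable.mul ?_)
    refine Complex.measurable_ofReal.comp (Measurable.ennreal_toReal ?_)
    -- The translate `aX` is the section at `a` of this measurable set, so its measure is measurable
    -- in `a`.
    have hm : MeasurableSet {p : Circle × Circle | p.1⁻¹ * p.2 ∈ X} :=
      (measurable_fst.inv.mul measurable_snd) hX
    convert measurable_measure_prodMk_left (ν := hF.diagonalMeasure φ) hm using 2 with a
    rw [Set.image_mul_left]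
    rfl
  · rw [norm_mul, norm_zpow, Circle.norm_coe, one_zpow, one_mul, Complex.norm_real,
      Real.norm_of_nonneg measureReal_nonneg]
    exact measureReal_mono (Set.subset_univ _)

/-- Polarization: only the diagonal set functions are positive measures, to which Fubini applies
directly. -/
theorem IsNormalizedPOM.exists_integral_image {F : Set Circle → H →L[ℂ] H}
    (hF : IsNormalizedPOM F) (φ ψ : H) (k : ℤ) :
    ∃ c : ℂ, ∀ X, MeasurableSet X →
      ∫ a : Circle, (a : ℂ) ^ (-k) * inner ℂ φ (F ((fun z => a * z) '' X) ψ) ∂torusHaar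
        = c * moment X k := by
  obtain ⟨c1, h1⟩ := hF.exists_integral_image_diagonal (φ + ψ) k
  obtain ⟨c2, h2⟩ := hF.exists_integral_image_diagonal (φ - ψ) k
  obtain ⟨c3, h3⟩ := hF.exists_integral_image_diagonal (φ + Complex.I • ψ) k
  obtain ⟨c4, h4⟩ := hF.exists_integral_image_diagonal (φ - Complex.I • ψ) k
  refine ⟨(c1 - c2 - Complex.I * c3 + Complex.I * c4) / 4, fun X hX => ?_⟩
  have pol : ∀ A : H →L[ℂ] H, inner ℂ φ (A ψ) = (inner ℂ (φ + ψ) (A (φ + ψ))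
      - inner ℂ (φ - ψ) (A (φ - ψ))
      - Complex.I * inner ℂ (φ + Complex.I • ψ) (A (φ + Complex.I • ψ))
      + Complex.I * inner ℂ (φ - Complex.I • ψ) (A (φ - Complex.I • ψ))) / 4 := by
    intro A
    simp only [map_add, map_sub, map_smul, inner_add_left, inner_add_right, inner_sub_left,
      inner_sub_right, inner_smul_left, inner_smul_right, Complex.conj_I]
    linear_combination (1 / 2 * inner ℂ φ (A ψ) - 1 / 2 * inner ℂ ψ (A φ)) * Complex.I_mul_I
  have e : ∀ a : Circle, (a : ℂ) ^ (-k) * inner ℂ φ (F ((fun z => a * z) '' X) ψ) =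
      (((a : ℂ) ^ (-k) * inner ℂ (φ + ψ) (F ((fun z => a * z) '' X) (φ + ψ))
      - (a : ℂ) ^ (-k) * inner ℂ (φ - ψ) (F ((fun z => a * z) '' X) (φ - ψ))
      - Complex.I * ((a : ℂ) ^ (-k) *
        inner ℂ (φ + Complex.I • ψ) (F ((fun z => a * z) '' X) (φ + Complex.I • ψ)))
      + Complex.I * ((a : ℂ) ^ (-k) *
        inner ℂ (φ - Complex.I • ψ) (F ((fun z => a * z) '' X) (φ - Complex.I • ψ)))) / 4) := by
    intro a
    rw [pol]
    ring
  simp_rw [e]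
  rw [integral_div, integral_add, integral_sub, integral_sub, integral_const_mul,
    integral_const_mul, (h1 X hX).2, (h2 X hX).2, (h3 X hX).2, (h4 X hX).2]
  · ring
  · exact (h1 X hX).1
  · exact (h2 X hX).1
  · exact (h1 X hX).1.sub (h2 X hX).1
  · exact (h3 X hX).1.const_mul _
  · exact ((h1 X hX).1.sub (h2 X hX).1).sub ((h3 X hX).1.const_mul _)
  · exact (h4 X hX).1.const_mul _

/-- By covariance the averaged integrand is constant in `a`, hence equals its average over the
probability measure `torusHaar`. -/
theorem IsCovariantObservable.exists_hasPhaseMatrix {d : ι → ℤ} {b : HilbertBasis ι ℂ H}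
    {U : Circle → H →L[ℂ] H} (hU : IsDiagonalAction d b U) {F : Set Circle → H →L[ℂ] H}
    (hF : IsCovariantObservable U F) : ∃ c, HasPhaseMatrix d b c F := by
  choose c hc using fun n m =>
    hF.isNormalizedPOM.exists_integral_image (b n) (b m) (d n - d m)
  refine ⟨c, fun X hX n m => ?_⟩
  rw [← hc n m X hX]
  have : ∀ a : Circle, (a : ℂ) ^ (-(d n - d m)) *
      inner ℂ (b n) (F ((fun z => a * z) '' X) (b m)) = inner ℂ (b n) (F X (b m)) := by
    intro a
    rw [(hU.covariant_iff a _ _).mp (hF.covariant a X hX) n m, ← mul_assoc,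
      ← zpow_add₀ (Circle.coe_ne_zero a)]
    simp
  simp_rw [this]
  simp

end Converse

/-! ## Phase matrices are Gram matrices -/

section Gram

open scoped ComplexOrder

variable {ι H : Type*} [NormedAddCommGroup H] [InnerProductSpace ℂ H]

theorem sum_inner_mul_eq_setIntegral {d : ι → ℤ} {b : HilbertBasis ι ℂ H} {c : ι → ι → ℂ}
    {F : Set Circle → H →L[ℂ] H} (hF : HasPhaseMatrix d b c F) (s : Finset ι) (x : ι → ℂ)
    {X : Set Circle} (hX : MeasurableSet X) :
    inner ℂ (∑ n ∈ s, x n • b n) (F X (∑ n ∈ s, x n • b n))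
      = ∫ z in X, ∑ n ∈ s, ∑ m ∈ s, (starRingEnd ℂ) (x n) * x m * c n m *
        (z : ℂ) ^ (d n - d m) ∂torusHaar := by
  rw [integral_finsetSum _ fun n _ => integrable_finsetSum _ fun m _ =>
    ((integrable_coe_zpow _ torusHaar).const_mul _).integrableOn]
  simp_rw [integral_finsetSum s fun m _ =>
    ((integrable_coe_zpow _ torusHaar).const_mul _).integrableOn, integral_const_mul]
  rw [sum_inner]
  refine Finset.sum_congr rfl fun n _ => ?_
  rw [map_sum, inner_sum]
  refine Finset.sum_congr rfl fun m _ => ?_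
  rw [map_smul, inner_smul_left, inner_smul_right, hF X hX]
  unfold moment
  ring

/-- The trigonometric polynomial `g` has nonnegative integral over every Borel set, so it is
nonnegative almost everywhere and, being continuous, everywhere. At `z = 1` all characters equal
one. -/
theorem HasPhaseMatrix.sum_nonneg [CompleteSpace H] {d : ι → ℤ} {b : HilbertBasis ι ℂ H}
    {c : ι → ι → ℂ}
    {F : Set Circle → H →L[ℂ] H} (hF : HasPhaseMatrix d b c F) (hP : IsNormalizedPOM F)
    (s : Finset ι) (x : ι → ℂ) :
    0 ≤ ∑ n ∈ s, ∑ m ∈ s, (starRingEnd ℂ) (x n) * x m * c n m := by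
  set g : Circle → ℂ := fun z => ∑ n ∈ s, ∑ m ∈ s, (starRingEnd ℂ) (x n) * x m * c n m *
        (z : ℂ) ^ (d n - d m) with hg
  have hgc : Continuous g := continuous_finsetSum _ fun n _ => continuous_finsetSum _ fun m _ =>
    continuous_const.mul (continuous_coe_zpow _)
  have hgi : Integrable g torusHaar := integrable_finsetSum _ fun n _ =>
    integrable_finsetSum _ fun m _ => (integrable_coe_zpow _ torusHaar).const_mul _
  have hpos : ∀ X, MeasurableSet X → 0 ≤ ∫ z in X, g z ∂torusHaar := fun X hX => by
    rw [hg, ← sum_inner_mul_eq_setIntegral hF s x hX]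
    exact (hP.positive X hX).inner_nonneg_right _
  have hre : ∀ z, 0 ≤ (g z).re := by
    have h1 : 0 ≤ᵐ[torusHaar] fun z => (g z).re := by
      refine ae_nonneg_of_forall_setIntegral_nonneg hgi.re fun X hX _ => ?_
      have h2 := integral_re (μ := torusHaar.restrict X) hgi.integrableOn
      exact (Complex.nonneg_iff.mp (hpos X hX)).1.trans_eq h2.symm
    have hcl : IsClosed {z | 0 ≤ (g z).re} :=
      isClosed_le continuous_const (Complex.continuous_re.comp hgc)
    -- A closed set of full Haar measure is dense, hence the whole torus.
    have := hcl.closure_eq ▸ (Measure.dense_of_ae h1).closure_eq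
    intro z
    exact (this ▸ Set.mem_univ z : z ∈ {z | 0 ≤ (g z).re})
  have him : ∀ z, (g z).im = 0 := by
    have h1 : (fun z => (g z).im) =ᵐ[torusHaar] 0 := by
      refine Integrable.ae_eq_zero_of_forall_setIntegral_eq_zero hgi.im fun X hX _ => ?_
      have h2 := integral_im (μ := torusHaar.restrict X) hgi.integrableOn
      exact h2.trans (Complex.nonneg_iff.mp (hpos X hX)).2.symm
    intro z
    exact congrFun ((Continuous.ae_eq_iff_eq torusHaar (Complex.continuous_im.comp hgc)
      continuous_zero).mp h1) z
  have h1 : g 1 = ∑ n ∈ s, ∑ m ∈ s, (starRingEnd ℂ) (x n) * x m * c n m := by simp [hg]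
  rw [← h1, Complex.nonneg_iff]
  exact ⟨hre 1, (him 1).symm⟩

theorem HasPhaseMatrix.diag_eq_one [CompleteSpace H] {d : ι → ℤ} {b : HilbertBasis ι ℂ H}
    {c : ι → ι → ℂ}
    {F : Set Circle → H →L[ℂ] H} (hF : HasPhaseMatrix d b c F) (hP : IsNormalizedPOM F) (n : ι) :
    c n n = 1 := by
  have h := hF _ .univ n n
  rw [hP.normalized, one_apply_eq_self, inner_self_eq_norm_sq_to_K,
    b.orthonormal.1 n, sub_self, moment_univ] at h
  simpa using h.symm

theorem norm_le_one_of_posSemidef {c : ι → ι → ℂ} (hdiag : ∀ n, c n n = 1)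
    (hc : ∀ (s : Finset ι) (x : ι → ℂ),
      0 ≤ ∑ n ∈ s, ∑ m ∈ s, (starRingEnd ℂ) (x n) * x m * c n m) (n m : ι) : ‖c n m‖ ≤ 1 := by
  classical
  by_cases hnm : n = m
  · simp [hnm, hdiag]
  have e : ∀ u v : ℂ, 0 ≤ (starRingEnd ℂ) u * u + (starRingEnd ℂ) u * v * c n m +
      ((starRingEnd ℂ) v * u * c m n + (starRingEnd ℂ) v * v) := by
    intro u v
    have h := hc {n, m} (fun i => if i = n then u else v)
    simpa [Finset.sum_pair hnm, hdiag, Ne.symm hnm] using h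
  -- Reality of the form at `(1, 1)` and `(1, i)` forces hermitian symmetry.
  have hsym : c m n = (starRingEnd ℂ) (c n m) := by
    have h1 := (Complex.nonneg_iff.mp (e 1 1)).2
    have h2 := (Complex.nonneg_iff.mp (e 1 Complex.I)).2
    simp at h1 h2
    apply Complex.ext
    · simp; linarith
    · simp; linarith
  -- At `(-c n m, 1)` the form equals `1 - |c n m|²`.
  have h := (Complex.nonneg_iff.mp (e (-c n m) 1)).1
  rw [hsym] at h
  simp at h
  have : ‖c n m‖ ^ 2 = (c n m).re * (c n m).re + (c n m).im * (c n m).im := by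
    rw [Complex.sq_norm, Complex.normSq_apply]
  nlinarith [norm_nonneg (c n m)]

theorem tendsto_partial_sum (b : HilbertBasis ℕ ℂ H) (φ : H) :
    Tendsto (fun N => ∑ n ∈ Finset.range N, inner ℂ (b n) φ • b n) atTop (𝓝 φ) := by
  have := (b.hasSum_repr φ).tendsto_sum_nat
  simpa [HilbertBasis.repr_apply_apply] using this

variable [CompleteSpace H]

/-- The matrix `c` need not define a bounded operator. Damping its entries by `2⁻ⁿ 2⁻ᵐ` gives a
norm-convergent sum `C ≥ 0` on `H`; factoring `C = B* B` and undoing the damping gives `ξ n = 2ⁿ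
B|n⟩` in `H` itself. -/
theorem exists_gram_of_posSemidef (b : HilbertBasis ℕ ℂ H) {c : ℕ → ℕ → ℂ}
    (hdiag : ∀ n, c n n = 1)
    (hc : ∀ (s : Finset ℕ) (x : ℕ → ℂ),
      0 ≤ ∑ n ∈ s, ∑ m ∈ s, (starRingEnd ℂ) (x n) * x m * c n m) :
    ∃ ξ : ℕ → H, ∀ n m, inner ℂ (ξ n) (ξ m) = c n m := by
  classical
  set r : ℕ → ℂ := fun n => ((1 / 2 : ℝ) ^ n : ℝ) with hr
  have hr0 : ∀ n, r n ≠ 0 := fun n => by simp [hr]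
  have hrc : ∀ n, (starRingEnd ℂ) (r n) = r n := fun n => Complex.conj_ofReal _
  have hsum : Summable fun p : ℕ × ℕ =>
      (r p.1 * r p.2 * c p.1 p.2) • InnerProductSpace.rankOne ℂ (b p.1) (b p.2) := by
    have hs : Summable fun n : ℕ => (1 / 2 : ℝ) ^ n := summable_geometric_two
    refine Summable.of_norm_bounded
      (hs.mul_of_nonneg hs (fun _ => by positivity) (fun _ => by positivity)) fun p => ?_
    rw [norm_smul, norm_mul, norm_mul, InnerProductSpace.norm_rankOne, b.orthonormal.1,
      b.orthonormal.1, mul_one, mul_one]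
    simp only [hr, Complex.norm_real, norm_pow]
    have := norm_le_one_of_posSemidef hdiag hc p.1 p.2
    refine (mul_le_of_le_one_right (by positivity) this).trans_eq ?_
    norm_num
  set C := ∑' p : ℕ × ℕ,
    (r p.1 * r p.2 * c p.1 p.2) • InnerProductSpace.rankOne ℂ (b p.1) (b p.2) with hC
  have hmat : ∀ n m, inner ℂ (b n) (C (b m)) = r n * r m * c n m := by
    intro n m
    have h1 : HasSum (fun p : ℕ × ℕ => inner ℂ (b n)
        (((r p.1 * r p.2 * c p.1 p.2) • InnerProductSpace.rankOne ℂ (b p.1) (b p.2)) (b m)))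
        (inner ℂ (b n) (C (b m))) :=
      hsum.hasSum.mapL ((innerSL ℂ (b n)).comp (ContinuousLinearMap.apply ℂ H (b m)))
    refine h1.unique ?_
    convert! hasSum_ite_eq (n, m) (r n * r m * c n m) using 2 with p
    rw [smul_apply, InnerProductSpace.rankOne_apply, inner_smul_right,
      inner_smul_right, orthonormal_iff_ite.mp b.orthonormal, orthonormal_iff_ite.mp b.orthonormal]
    rcases p with ⟨i, j⟩
    by_cases h1 : n = i <;> by_cases h2 : j = m <;> simp [h1, h2, Prod.ext_iff, eq_comm]
    exact fun h => absurd h.symm h2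
  have hpos : ∀ φ, 0 ≤ inner ℂ φ (C φ) := by
    intro φ
    have ht := tendsto_partial_sum b φ
    have ht2 := ht.inner (𝕜 := ℂ) ((C.continuous.tendsto φ).comp ht)
    refine ge_of_tendsto' ht2 fun N => ?_
    -- The quadratic form of `C` on a partial sum of `φ` is that of `c` at the damped coefficients.
    have := hc (Finset.range N) fun n => r n * inner ℂ (b n) φ
    refine this.trans_eq ?_
    simp only [Function.comp]
    rw [sum_inner]
    refine Finset.sum_congr rfl fun n _ => ?_
    rw [map_sum, inner_sum]
    refine Finset.sum_congr rfl fun m _ => ?_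
    rw [map_smul, inner_smul_left, inner_smul_right, hmat, map_mul, hrc]
    ring
  have hCpos : C.IsPositive := by
    rw [ContinuousLinearMap.isPositive_iff_complex]
    intro φ
    have h := hpos φ
    have h' : 0 ≤ inner ℂ (C φ) φ := by
      rw [← inner_conj_symm]
      exact star_nonneg_iff.mpr h
    obtain ⟨h1, h2⟩ := Complex.nonneg_iff.mp h'
    exact ⟨Complex.ext (by simp) (by simpa using h2), h1⟩
  rw [← ContinuousLinearMap.nonneg_iff_isPositive] at hCpos
  obtain ⟨B, hB⟩ := CStarAlgebra.nonneg_iff_eq_star_mul_self.mp hCpos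
  refine ⟨fun n => (r n)⁻¹ • B (b n), fun n m => ?_⟩
  have h1 : inner ℂ (B (b n)) (B (b m)) = r n * r m * c n m := by
    rw [← hmat, hB, mul_apply_eq_comp, ContinuousLinearMap.star_eq_adjoint,
      ContinuousLinearMap.adjoint_inner_right]
  rw [inner_smul_left, inner_smul_right, h1, map_inv₀, hrc]
  field_simp [hr0 n, hr0 m]

end Gram

/-! ## Phase observables and generating sequences -/

section Phase

variable {H : Type*} [NormedAddCommGroup H] [InnerProductSpace ℂ H] [CompleteSpace H]

theorem isDiagonalAction_numberShift (b : HilbertBasis ℕ ℂ H) :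
    IsDiagonalAction (fun n : ℕ => (n : ℤ)) b (numberShift b) := fun a n => by
  have h : numberShift b a (b n) = ((a ^ n : Circle) : ℂ) • b n :=
    basisIsometry_apply_basis b (orthonormal_phase_smul b a) n
  simpa using h

/-- Tested on basis vectors, the rectangular sums are eventually constant. Conversely, they equal
`⟨P φ|F(X) Q ψ⟩` with `P`, `Q` the projections onto initial basis segments, and converge since `P φ
→ φ` and `Q ψ → ψ`. -/
theorem isGeneratedBy_iff_hasPhaseMatrix (b : HilbertBasis ℕ ℂ H) (ξ : ℕ → H)
    (F : Set Circle → H →L[ℂ] H) :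
    IsGeneratedBy b ξ F ↔
      HasPhaseMatrix (fun n : ℕ => (n : ℤ)) b (fun n m => inner ℂ (ξ n) (ξ m)) F := by
  refine forall₂_congr fun X hX => ?_
  rw [ContinuousLinearMapWOT.tendsto_iff_forall_inner_apply_tendsto]
  have key : ∀ (p : ℕ × ℕ) (φ ψ : H), inner ℂ φ (ContinuousLinearMapWOT.ofCLM
        (∑ n ∈ Finset.range p.1, ∑ m ∈ Finset.range p.2,
          (inner ℂ (ξ n) (ξ m) * ∫ z in X, (z : ℂ) ^ ((n : ℤ) - (m : ℤ)) ∂torusHaar) •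
            InnerProductSpace.rankOne ℂ (b n) (b m)) ψ)
      = ∑ n ∈ Finset.range p.1, ∑ m ∈ Finset.range p.2,
          inner ℂ φ (b n) * inner ℂ (b m) ψ * (inner ℂ (ξ n) (ξ m) * moment X (n - m)) := by
    intro p φ ψ
    rw [ContinuousLinearMapWOT.coe_ofCLM]
    simp only [sum_apply, inner_sum]
    refine Finset.sum_congr rfl fun n _ => Finset.sum_congr rfl fun m _ => ?_
    rw [smul_apply, InnerProductSpace.rankOne_apply, inner_smul_right, inner_smul_right]
    unfold moment
    ring
  simp only [key]
  simp only [ContinuousLinearMapWOT.coe_ofCLM]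
  constructor
  · intro h n m
    refine tendsto_nhds_unique (h (b m) (b n)) (tendsto_const_nhds.congr' ?_)
    filter_upwards [eventually_ge_atTop (n + 1, m + 1)] with p hp
    obtain ⟨h1, h2⟩ := Prod.mk_le_mk.mp hp
    symm
    rw [Finset.sum_eq_single n, Finset.sum_eq_single m]
    · simp [b.orthonormal.1]
    · intro j _ hj
      simp [orthonormal_iff_ite.mp b.orthonormal j m, hj]
    · intro hm
      exact absurd (Finset.mem_range.mpr (by omega)) hm
    · intro j _ hj
      simp [orthonormal_iff_ite.mp b.orthonormal n j, Ne.symm hj]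
    · intro hn
      exact absurd (Finset.mem_range.mpr (by omega)) hn
  · intro h ψ φ
    have h1 := (tendsto_partial_sum b φ).comp (tendsto_fst (f := atTop) (g := atTop (α := ℕ)))
    have h2 := ((F X).continuous.tendsto ψ).comp
      ((tendsto_partial_sum b ψ).comp (tendsto_snd (f := atTop (α := ℕ)) (g := atTop)))
    rw [← prod_atTop_atTop_eq]
    refine (h1.inner (𝕜 := ℂ) h2).congr fun p => ?_
    simp only [Function.comp]
    rw [sum_inner]
    refine Finset.sum_congr rfl fun n _ => ?_
    rw [map_sum, inner_sum]
    refine Finset.sum_congr rfl fun m _ => ?_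
    rw [map_smul, inner_smul_left, inner_smul_right, h, inner_conj_symm]
    ring

theorem IsGeneratedBy.inner_apply {b : HilbertBasis ℕ ℂ H} {ξ : ℕ → H}
    {F : Set Circle → H →L[ℂ] H} (hF : IsGeneratedBy b ξ F) {X : Set Circle}
    (hX : MeasurableSet X) (n m : ℕ) :
    inner ℂ (b n) (F X (b m)) = inner ℂ (ξ n) (ξ m) * moment X ((n : ℤ) - m) :=
  (isGeneratedBy_iff_hasPhaseMatrix b ξ F).mp hF X hX n m

theorem IsPhaseObservable.exists_isGeneratedBy {b : HilbertBasis ℕ ℂ H}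
    {F : Set Circle → H →L[ℂ] H} (hF : IsPhaseObservable b F) :
    ∃ ξ : ℕ → H, (∀ n, ‖ξ n‖ = 1) ∧ IsGeneratedBy b ξ F := by
  obtain ⟨c, hc⟩ := hF.exists_hasPhaseMatrix (isDiagonalAction_numberShift b)
  have hdiag := hc.diag_eq_one hF.isNormalizedPOM
  obtain ⟨ξ, hξ⟩ := exists_gram_of_posSemidef b hdiag (hc.sum_nonneg hF.isNormalizedPOM)
  refine ⟨ξ, fun n => ?_, (isGeneratedBy_iff_hasPhaseMatrix b ξ F).mpr fun X hX n m => ?_⟩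
  · have h := hξ n n
    rw [hdiag, inner_self_eq_norm_sq_to_K] at h
    have h' : ((‖ξ n‖ ^ 2 : ℝ) : ℂ) = 1 := by rw [← h]; push_cast; rfl
    exact (pow_eq_one_iff_of_nonneg (norm_nonneg _) two_ne_zero).mp (by exact_mod_cast h')
  · rw [hc X hX, ← hξ]

theorem exists_isPhaseObservable_isGeneratedBy (b : HilbertBasis ℕ ℂ H) {ξ : ℕ → H}
    (hξ : ∀ n, ‖ξ n‖ = 1) :
    ∃ F : Set Circle → H →L[ℂ] H, IsPhaseObservable b F ∧ IsGeneratedBy b ξ F := by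
  obtain ⟨F, hP, hF⟩ := exists_hasPhaseMatrix_gram (d := fun n : ℕ => (n : ℤ))
    Nat.cast_injective b hξ
  exact ⟨F, hF.isCovariantObservable (isDiagonalAction_numberShift b) hP,
    (isGeneratedBy_iff_hasPhaseMatrix b ξ F).mpr hF⟩

theorem IsGeneratedBy.sameObservable_iff {b : HilbertBasis ℕ ℂ H} {ξ η : ℕ → H}
    {F G : Set Circle → H →L[ℂ] H} (hF : IsGeneratedBy b ξ F) (hG : IsGeneratedBy b η G) :
    SameObservable F G ↔ ∀ n m : ℕ, inner ℂ (ξ n) (ξ m) = inner ℂ (η n) (η m) :=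
  ((isGeneratedBy_iff_hasPhaseMatrix b ξ F).mp hF).sameObservable_iff
    ((isGeneratedBy_iff_hasPhaseMatrix b η G).mp hG)

theorem isPhaseObservable_iff_exists_isGeneratedBy (b : HilbertBasis ℕ ℂ H)
    (F : Set Circle → H →L[ℂ] H) :
    IsPhaseObservable b F ↔ ∃ ξ : ℕ → H, (∀ n, ‖ξ n‖ = 1) ∧ IsGeneratedBy b ξ F := by
  refine ⟨fun hF => hF.exists_isGeneratedBy, ?_⟩
  rintro ⟨ξ, hξ, hF⟩
  obtain ⟨G, hG, hG'⟩ := exists_isPhaseObservable_isGeneratedBy b hξ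
  exact IsCovariantObservable.congr hG ((hF.sameObservable_iff hG').mpr fun _ _ => rfl)

end Phase

/-! ## Fourier basis of `L²(𝕋, μ)` and compressions of localization observables -/

section Fourier

theorem monomialMap_apply (n : ℤ) (z : Circle) : monomialMap n z = (z : ℂ) ^ n := by
  simp [monomialMap]

/-- The star subalgebra of `C(𝕋, ℂ)` generated by the monomials. -/
def monomialSubalgebra : StarSubalgebra ℂ C(Circle, ℂ) where
  toSubalgebra := Algebra.adjoin ℂ (Set.range monomialMap)
  star_mem' := by
    change Algebra.adjoin ℂ (Set.range monomialMap) ≤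
      star (Algebra.adjoin ℂ (Set.range monomialMap))
    refine Algebra.adjoin_le ?_
    rintro _ ⟨n, rfl⟩
    refine Algebra.subset_adjoin ⟨-n, ?_⟩
    ext z
    rw [monomialMap_apply, ContinuousMap.star_apply, monomialMap_apply, RCLike.star_def,
      map_zpow₀, ← Circle.coe_inv_eq_conj, Circle.coe_inv, inv_zpow, zpow_neg]

theorem monomialSubalgebra_coe : Subalgebra.toSubmodule monomialSubalgebra.toSubalgebra
    = Submodule.span ℂ (Set.range monomialMap) := by
  apply Algebra.adjoin_eq_span_of_subset
  refine Set.Subset.trans ?_ Submodule.subset_span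
  intro x hx
  refine Submonoid.closure_induction (fun _ => id) ⟨0, ?_⟩ ?_ hx
  · ext z
    simp [monomialMap_apply]
  · rintro _ _ _ _ ⟨m, rfl⟩ ⟨n, rfl⟩
    refine ⟨m + n, ?_⟩
    ext z
    simp [monomialMap_apply, zpow_add₀]

/-- Stone–Weierstrass; the monomial `z` alone separates points. -/
theorem span_monomialMap_closure_eq_top :
    (Submodule.span ℂ (Set.range monomialMap)).topologicalClosure = ⊤ := by
  rw [← monomialSubalgebra_coe]
  refine congr_arg (Subalgebra.toSubmodule <| StarSubalgebra.toSubalgebra ·)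
    (ContinuousMap.starSubalgebra_topologicalClosure_eq_top_of_separatesPoints
      monomialSubalgebra fun x y hxy => ?_)
  refine ⟨_, ⟨monomialMap 1, Algebra.subset_adjoin ⟨1, rfl⟩, rfl⟩, ?_⟩
  simpa [monomialMap_apply, Circle.ext_iff] using hxy

theorem span_monomialL2_closure_eq_top :
    (Submodule.span ℂ (Set.range monomialL2)).topologicalClosure = ⊤ := by
  convert!
    (ContinuousMap.toLp_denseRange ℂ torusHaar ℂ (p := 2)
      (by norm_num)).topologicalClosure_map_submodule span_monomialMap_closure_eq_top
  rw [Submodule.map_span, ← Set.range_comp]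
  rfl

/-- The Hilbert basis `(e_n)` of `L²(𝕋, μ)`. -/
def monomialBasis : HilbertBasis ℤ ℂ L2Torus :=
  HilbertBasis.mk orthonormal_monomialL2 span_monomialL2_closure_eq_top.ge

theorem monomialBasis_apply (n : ℤ) : monomialBasis n = monomialL2 n := by
  rw [monomialBasis, HilbertBasis.coe_mk]

theorem monomialL2_ae (n : ℤ) : monomialL2 n =ᵐ[torusHaar] fun z => (z : ℂ) ^ n := by
  filter_upwards [ContinuousMap.coeFn_toLp (E := ℂ) (p := 2) (𝕜 := ℂ) torusHaar (monomialMap n)]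
    with z hz
  rw [monomialL2, hz, monomialMap_apply]

theorem isDiagonalAction_torusShift : IsDiagonalAction id monomialBasis torusShift := by
  intro a n
  rw [monomialBasis_apply]
  apply Lp.ext
  have hmp := measurePreserving_mul_left torusHaar a
  have h1 : torusShift a (monomialL2 n) =ᵐ[torusHaar] monomialL2 n ∘ (fun z => a * z) :=
    Lp.coeFn_compMeasurePreserving (monomialL2 n) hmp
  filter_upwards [h1, hmp.quasiMeasurePreserving.ae_eq_comp (monomialL2_ae n), monomialL2_ae n,
    Lp.coeFn_smul ((a : ℂ) ^ id n) (monomialL2 n)] with z h2 h3 h4 h5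
  rw [h2, h3, h5, Pi.smul_apply, h4]
  simp [mul_zpow]

variable {H : Type*} [NormedAddCommGroup H] [InnerProductSpace ℂ H]

/-- A preimage of `e_{-1}` would be orthogonal to every `|n⟩`, hence zero. -/
theorem not_surjective_numberToTorus (b : HilbertBasis ℕ ℂ H) :
    ¬ Function.Surjective (numberToTorus b) := by
  intro h
  obtain ⟨φ, hφ⟩ := h (monomialL2 (-1))
  have h0 : φ = 0 := by
    refine ext_inner_basis b fun n => ?_
    have h1 : inner ℂ (numberToTorus b (b n)) (numberToTorus b φ) = inner ℂ (b n) φ :=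
      LinearIsometry.inner_map_map _ _ _
    rw [← h1, hφ, numberToTorus_basis, inner_zero_right]
    exact orthonormal_monomialL2.2 (by omega)
  have h1 := orthonormal_monomialL2.1 (-1)
  rw [← hφ, h0] at h1
  simp at h1

variable [CompleteSpace H]

theorem IsNormalizedPOM.compress {K : Type*} [NormedAddCommGroup K] [InnerProductSpace ℂ K]
    [CompleteSpace K] {E : Set Circle → K →L[ℂ] K} (hE : IsNormalizedPOM E) (T : H →L[ℂ] K)
    (hT : T.adjoint ∘L T = 1) : IsNormalizedPOM fun X => T.adjoint ∘L E X ∘L T := by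
  refine ⟨fun X hX => (hE.positive X hX).adjoint_conj T, ?_, fun f hf hd => ?_⟩
  · simp only [hE.normalized]
    exact hT
  · refine (hasSum_ofCLM_iff _ _).mpr fun φ ψ => ?_
    simp only [ContinuousLinearMap.comp_apply, ContinuousLinearMap.adjoint_inner_right]
    exact (hasSum_ofCLM_iff _ _).mp (hE.sigma_additive f hf hd) _ _

theorem adjoint_comp_numberToTorus (b : HilbertBasis ℕ ℂ H) :
    (numberToTorus b).adjoint ∘L numberToTorus b = 1 := by
  refine ContinuousLinearMap.ext fun ψ => ext_inner_left ℂ fun φ => ?_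
  rw [ContinuousLinearMap.comp_apply, ContinuousLinearMap.adjoint_inner_right]
  exact LinearIsometry.inner_map_map _ _ _

theorem inner_basis_compress (b : HilbertBasis ℕ ℂ H) (A : L2Torus →L[ℂ] L2Torus) (n m : ℕ) :
    inner ℂ (b n) (((numberToTorus b).adjoint ∘L A ∘L numberToTorus b) (b m))
      = inner ℂ (monomialBasis n) (A (monomialBasis m)) := by
  rw [ContinuousLinearMap.comp_apply, ContinuousLinearMap.comp_apply,
    ContinuousLinearMap.adjoint_inner_right, numberToTorus_basis, numberToTorus_basis,
    monomialBasis_apply, monomialBasis_apply]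

theorem IsLocalizationObservable.isPhaseObservable_compress (b : HilbertBasis ℕ ℂ H)
    {E : Set Circle → L2Torus →L[ℂ] L2Torus} (hE : IsLocalizationObservable E) :
    IsPhaseObservable b
      fun X => (numberToTorus b).adjoint ∘L E X ∘L numberToTorus b := by
  refine ⟨hE.isNormalizedPOM.compress _ (adjoint_comp_numberToTorus b), fun a X hX => ?_⟩
  refine ((isDiagonalAction_numberShift b).covariant_iff a _ _).mpr fun n m => ?_
  rw [inner_basis_compress, inner_basis_compress]
  exact (isDiagonalAction_torusShift.covariant_iff a _ _).mp (hE.covariant a X hX) n m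

theorem isPhaseObservable_iff_exists_compress (b : HilbertBasis ℕ ℂ H)
    (F : Set Circle → H →L[ℂ] H) :
    IsPhaseObservable b F ↔
      ∃ E : Set Circle → L2Torus →L[ℂ] L2Torus, IsLocalizationObservable E ∧
        ∀ X, MeasurableSet X →
          F X = (numberToTorus b).adjoint ∘L E X ∘L numberToTorus b := by
  constructor
  · intro hF
    obtain ⟨ξ, hξ, hg⟩ := hF.exists_isGeneratedBy
    -- `Int.toNat` assigns `ξ 0` to all negative indices. Any unit vectors would do, as the
    -- compression sees only nonnegative indices.
    obtain ⟨E, hP, hE⟩ := exists_hasPhaseMatrix_gram (d := (id : ℤ → ℤ)) Function.injective_id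
      monomialBasis (ξ := fun k : ℤ => ξ k.toNat) (fun k => hξ _)
    refine ⟨E, hE.isCovariantObservable isDiagonalAction_torusShift hP, fun X hX => ?_⟩
    refine clm_ext_matrix b fun n m => ?_
    rw [inner_basis_compress, hE X hX, hg.inner_apply hX]
    simp
  · rintro ⟨E, hE, h⟩
    exact IsCovariantObservable.congr (hE.isPhaseObservable_compress b) h

end Fourier

/-! ## Equivalence of phase observables -/

section Equivalence

variable {H : Type*} [NormedAddCommGroup H] [InnerProductSpace ℂ H]

theorem symm_apply_of_diagonal {b : HilbertBasis ℕ ℂ H} {W : H ≃ₗᵢ[ℂ] H}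
    {w : ℕ → Circle} (hW : ∀ n, W (b n) = (w n : ℂ) • b n) (n : ℕ) :
    W.symm (b n) = ((w n : ℂ)⁻¹) • b n := by
  rw [LinearIsometryEquiv.symm_apply_eq, map_smul, hW, smul_smul,
    inv_mul_cancel₀ (Circle.coe_ne_zero _), one_smul]

theorem intertwines_iff_of_diagonal {b : HilbertBasis ℕ ℂ H} {W : H ≃ₗᵢ[ℂ] H}
    {w : ℕ → Circle} (hW : ∀ n, W (b n) = (w n : ℂ) • b n) (A B : H →L[ℂ] H) :
    (∀ φ, W (A φ) = B (W φ)) ↔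
      ∀ n m, inner ℂ (b n) (B (b m)) =
        (w n : ℂ) * (w m : ℂ)⁻¹ * inner ℂ (b n) (A (b m)) := by
  have h1 : ∀ n m, inner ℂ (b n) (W (A (b m))) = (w n : ℂ) * inner ℂ (b n) (A (b m)) := by
    intro n m
    rw [← W.symm.inner_map_map, W.symm_apply_apply,
      symm_apply_of_diagonal hW, inner_smul_left, map_inv₀,
      ← Circle.coe_inv_eq_conj, Circle.coe_inv, inv_inv]
  have h2 : ∀ n m, inner ℂ (b n) (B (W (b m))) = (w m : ℂ) * inner ℂ (b n) (B (b m)) := by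
    intro n m
    rw [hW, map_smul, inner_smul_right]
  have h3 : (∀ φ, W (A φ) = B (W φ)) ↔
      ∀ n m, (w n : ℂ) * inner ℂ (b n) (A (b m)) = (w m : ℂ) * inner ℂ (b n) (B (b m)) := by
    constructor
    · intro h n m
      rw [← h1, ← h2, h]
    · intro h φ
      have : W.toContinuousLinearEquiv.toContinuousLinearMap ∘L A
          = B ∘L W.toContinuousLinearEquiv.toContinuousLinearMap :=
        clm_ext_matrix b fun n m => ((h1 n m).trans (h n m)).trans (h2 n m).symm
      exact congrArg (fun T : H →L[ℂ] H => T φ) this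
  rw [h3]
  refine forall₂_congr fun n m => ?_
  have hm := Circle.coe_ne_zero (w m)
  constructor
  · intro h
    rw [mul_right_comm, h]
    field_simp
  · intro h
    rw [h]
    field_simp

variable [CompleteSpace H]

/-- The characters `a ^ n` are pairwise distinct, so commuting with them kills the off-diagonal
entries of `W`; isometry makes the diagonal ones unimodular. -/
theorem exists_diagonal_of_commute_numberShift {b : HilbertBasis ℕ ℂ H} {W : H ≃ₗᵢ[ℂ] H}
    (hW : ∀ (a : Circle) (φ : H), W (numberShift b a φ) = numberShift b a (W φ)) :
    ∃ w : ℕ → Circle, ∀ n, W (b n) = (w n : ℂ) • b n := by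
  have hd := isDiagonalAction_numberShift b
  have hoff : ∀ n m, m ≠ n → inner ℂ (b m) (W (b n)) = 0 := by
    intro n m hmn
    obtain ⟨a, ha⟩ := exists_circle_zpow_ne_one (k := (n : ℤ) - m) (by omega)
    have h := congrArg (inner ℂ (b m)) (hW a (b n))
    rw [hd, map_smul, inner_smul_right, ← ContinuousLinearMap.adjoint_inner_left,
      hd.adjoint_apply, inner_smul_left, map_zpow₀, ← Circle.coe_inv_eq_conj, Circle.coe_inv,
      inv_zpow, zpow_neg, inv_inv] at h
    by_contra h0
    have h1 := mul_right_cancel₀ h0 h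
    apply ha
    rw [zpow_sub, mul_inv_eq_one]
    exact Circle.ext (by simpa using h1)
  have hW' : ∀ n, W (b n) = inner ℂ (b n) (W (b n)) • b n := by
    intro n
    refine ext_inner_basis b fun m => ?_
    rw [inner_smul_right, orthonormal_iff_ite.mp b.orthonormal]
    split_ifs with h
    · rw [h, mul_one]
    · rw [hoff n m h, mul_zero]
  have hn : ∀ n, ‖(inner ℂ (b n) (W (b n)) : ℂ)‖ = 1 := by
    intro n
    have h1 : ‖W (b n)‖ = 1 := by rw [W.norm_map, b.orthonormal.1]
    rwa [hW', norm_smul, b.orthonormal.1, mul_one] at h1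
  exact ⟨fun n => ⟨inner ℂ (b n) (W (b n)), mem_sphere_zero_iff_norm.mpr (hn n)⟩, hW'⟩

theorem exists_diagonal_unitary (b : HilbertBasis ℕ ℂ H) (w : ℕ → Circle) :
    ∃ W : H ≃ₗᵢ[ℂ] H, ∀ n, W (b n) = (w n : ℂ) • b n := by
  have ho : Orthonormal ℂ fun n => (w n : ℂ) • b n := by
    refine ⟨fun n => by rw [norm_smul, b.orthonormal.1, Circle.norm_coe, mul_one], fun i j hij => ?_⟩
    simp [inner_smul_left, inner_smul_right, b.orthonormal.2 hij]
  have hs : ⊤ ≤ (Submodule.span ℂ (Set.range fun n => (w n : ℂ) • b n)).topologicalClosure := by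
    rw [← b.dense_span]
    refine Submodule.topologicalClosure_mono (Submodule.span_le.mpr ?_)
    rintro _ ⟨n, rfl⟩
    have h := Submodule.smul_mem _ (w n : ℂ)⁻¹ (Submodule.subset_span (R := ℂ)
      (Set.mem_range_self (f := fun n => (w n : ℂ) • b n) n))
    simpa [smul_smul] using h
  refine ⟨b.repr.trans (HilbertBasis.mk ho hs).repr.symm, fun n => ?_⟩
  rw [LinearIsometryEquiv.trans_apply, HilbertBasis.repr_self, HilbertBasis.repr_symm_single,
    HilbertBasis.coe_mk]

theorem IsGeneratedBy.equivalentObservables_iff {b : HilbertBasis ℕ ℂ H} {ξ ξ' : ℕ → H}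
    {F F' : Set Circle → H →L[ℂ] H} (hF : IsGeneratedBy b ξ F) (hF' : IsGeneratedBy b ξ' F') :
    EquivalentObservables (numberShift b) F F' ↔
      ∃ z : ℕ → Circle, ∀ n m : ℕ,
        inner ℂ (ξ' n) (ξ' m) = inner ℂ ((z n : ℂ) • ξ n) ((z m : ℂ) • ξ m) := by
  have hin : ∀ (z : ℕ → Circle) (n m : ℕ), inner ℂ ((z n : ℂ) • ξ n) ((z m : ℂ) • ξ m)
      = (z n : ℂ)⁻¹ * (z m : ℂ) * inner ℂ (ξ n) (ξ m) := by
    intro z n m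
    rw [inner_smul_left, inner_smul_right, ← Circle.coe_inv_eq_conj, Circle.coe_inv, mul_assoc]
  constructor
  · rintro ⟨W, hU, hW⟩
    obtain ⟨w, hw⟩ := exists_diagonal_of_commute_numberShift hU
    -- Conjugation by `W` multiplies entries by `w n (w m)⁻¹`, while rephasing the vectors by `z`
    -- multiplies the Gram matrix by `(z n)⁻¹ z m`; hence the inverse.
    refine ⟨fun n => (w n)⁻¹, fun n m => ?_⟩
    obtain ⟨X, hX, h0⟩ := exists_moment_ne_zero ((n : ℤ) - m)
    have h := (intertwines_iff_of_diagonal hw _ _).mp (hW X hX) n m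
    rw [hF.inner_apply hX, hF'.inner_apply hX, ← mul_assoc] at h
    rw [hin (fun n => (w n)⁻¹), mul_right_cancel₀ h0 h]
    simp
  · rintro ⟨z, hz⟩
    obtain ⟨W, hw⟩ := exists_diagonal_unitary b fun n => (z n)⁻¹
    refine ⟨W, fun a φ => ?_, fun X hX => (intertwines_iff_of_diagonal hw _ _).mpr fun n m => ?_⟩
    · have hd := isDiagonalAction_numberShift b
      have : W.toContinuousLinearEquiv.toContinuousLinearMap ∘L numberShift b a
          = numberShift b a ∘L W.toContinuousLinearEquiv.toContinuousLinearMap := by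
        refine clm_ext_basis b fun n => ?_
        change W (numberShift b a (b n)) = numberShift b a (W (b n))
        rw [hd, map_smul, hw, map_smul, hd, smul_comm]
      exact congrArg (fun T : H →L[ℂ] H => T φ) this
    · rw [hF.inner_apply hX, hF'.inner_apply hX, hz, hin]
      simp [mul_assoc]

end Equivalence

/-! ## No phase observable is projection valued -/

section Projection

variable {H : Type*} [NormedAddCommGroup H] [InnerProductSpace ℂ H] [CompleteSpace H]

theorem inner_monomialL2_indicator {X : Set Circle} (hX : MeasurableSet X) (k : ℤ) :
    inner ℂ (monomialL2 k) (indicatorConstLp 2 hX (measure_ne_top torusHaar X) (1 : ℂ))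
      = moment X (-k) := by
  rw [← inner_conj_symm, L2.inner_indicatorConstLp_one, ← conj_moment]
  congr 1
  exact integral_congr_ae (ae_restrict_of_ae (monomialL2_ae k))

/-- Bessel's inequality for `χ_X`, whose Fourier coefficients are its moments. -/
theorem sum_norm_moment_sq_le {X : Set Circle} (hX : MeasurableSet X) (s : Finset ℤ) :
    ∑ k ∈ s, ‖moment X k‖ ^ 2 ≤ torusHaar.real X := by
  have h := orthonormal_monomialL2.sum_inner_products_le (s := s)
    (indicatorConstLp 2 hX (measure_ne_top torusHaar X) (1 : ℂ))
  rw [norm_indicatorConstLp (by norm_num) (by norm_num)] at h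
  simp_rw [inner_monomialL2_indicator, ← conj_moment, RCLike.norm_conj] at h
  refine h.trans_eq ?_
  rw [norm_one, one_mul, ENNReal.toReal_ofNat, ← Real.sqrt_eq_rpow,
    Real.sq_sqrt measureReal_nonneg]

/-- If `F(X)` is a projection then `‖F(X)|0⟩‖² = ⟨0|F(X)0⟩ = μ(X)`. The components of `F(X)|0⟩` are
bounded by the moments of index `n ≥ 0`, whose squares sum to at most `μ(X) - |moment X (-1)|²`,
strictly less for the chosen `X`. -/
theorem IsPhaseObservable.not_isProjectionValued {b : HilbertBasis ℕ ℂ H}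
    {F : Set Circle → H →L[ℂ] H} (hF : IsPhaseObservable b F) : ¬ IsProjectionValued F := by
  intro hproj
  obtain ⟨ξ, hξ, hg⟩ := hF.exists_isGeneratedBy
  obtain ⟨X, hX, h0⟩ := exists_moment_ne_zero (-1)
  have hsum : HasSum (fun n => ‖inner ℂ (b n) (F X (b 0))‖ ^ 2) (torusHaar.real X) := by
    have h1 := b.hasSum_inner_mul_inner (F X (b 0)) (F X (b 0))
    have h2 : inner ℂ (F X (b 0)) (F X (b 0)) = (torusHaar.real X : ℂ) := by
      rw [(hF.isNormalizedPOM.positive X hX).inner_left_eq_inner_right]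
      have : F X (F X (b 0)) = F X (b 0) := congrArg (fun T : H →L[ℂ] H => T (b 0)) (hproj X hX)
      rw [this, hg.inner_apply hX, sub_self, moment_zero, inner_self_eq_norm_sq_to_K, hξ]
      simp
    rw [h2] at h1
    have h3 := Complex.hasSum_re h1
    rw [Complex.ofReal_re] at h3
    convert! h3 using 2 with n
    rw [← inner_conj_symm (F X (b 0)), ← Complex.normSq_eq_conj_mul_self, Complex.ofReal_re,
      Complex.normSq_eq_norm_sq]
  have hle : torusHaar.real X ≤ torusHaar.real X - ‖moment X (-1)‖ ^ 2 := by
    refine hasSum_le_of_sum_le hsum fun s => ?_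
    -- The index `-1`, invisible to `H`, is what makes the inequality strict.
    have h1 := sum_norm_moment_sq_le hX (insert (-1) (s.map Nat.castEmbedding))
    rw [Finset.sum_insert (by simp), Finset.sum_map] at h1
    have h2 : ∑ n ∈ s, ‖inner ℂ (b n) (F X (b 0))‖ ^ 2
        ≤ ∑ n ∈ s, ‖moment X (Nat.castEmbedding n)‖ ^ 2 := by
      refine Finset.sum_le_sum fun n _ => ?_
      have h3 : ‖inner ℂ (ξ n) (ξ 0)‖ ≤ 1 := by
        simpa [hξ] using norm_inner_le_norm (𝕜 := ℂ) (ξ n) (ξ 0)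
      rw [hg.inner_apply hX, norm_mul]
      simp only [Nat.cast_zero, sub_zero, Nat.castEmbedding_apply]
      gcongr
      exact mul_le_of_le_one_left (norm_nonneg _) h3
    linarith
  have : 0 < ‖moment X (-1)‖ ^ 2 := by positivity
  linarith

end Projection

end CovariantPhase

end

theorem mainTheorem2 {H : Type*} [NormedAddCommGroup H] [InnerProductSpace ℂ H] [CompleteSpace H]
    (b : HilbertBasis ℕ ℂ H) :
    -- phase observables are the compressions of localization observables
    (∀ F : Set Circle → H →L[ℂ] H,
      CovariantPhase.IsPhaseObservable b F ↔
        ∃ E : Set Circle → CovariantPhase.L2Torus →L[ℂ] CovariantPhase.L2Torus,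
          CovariantPhase.IsLocalizationObservable E ∧
          ∀ X, MeasurableSet X →
            F X = (CovariantPhase.numberToTorus b).adjoint ∘L E X ∘L
              CovariantPhase.numberToTorus b) ∧
    -- phase observables are the operator measures generated by sequences of unit vectors
    (∀ F : Set Circle → H →L[ℂ] H,
      CovariantPhase.IsPhaseObservable b F ↔
        ∃ ξ : ℕ → H, (∀ n, ‖ξ n‖ = 1) ∧ CovariantPhase.IsGeneratedBy b ξ F) ∧
    -- every sequence of unit vectors generates a phase observable
    (∀ ξ : ℕ → H, (∀ n, ‖ξ n‖ = 1) →
      ∃ F : Set Circle → H →L[ℂ] H,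
        CovariantPhase.IsPhaseObservable b F ∧ CovariantPhase.IsGeneratedBy b ξ F) ∧
    -- two sequences of unit vectors generate the same observable iff their Gram matrices agree
    (∀ ξ η : ℕ → H, (∀ n, ‖ξ n‖ = 1) → (∀ n, ‖η n‖ = 1) →
      ∀ F G : Set Circle → H →L[ℂ] H,
        CovariantPhase.IsGeneratedBy b ξ F → CovariantPhase.IsGeneratedBy b η G →
        (CovariantPhase.SameObservable F G ↔
          ∀ n m : ℕ, inner ℂ (ξ n) (ξ m) = inner ℂ (η n) (η m))) ∧
    -- equivalence of phase observables in terms of generating sequences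
    (∀ F F' : Set Circle → H →L[ℂ] H,
      CovariantPhase.IsPhaseObservable b F → CovariantPhase.IsPhaseObservable b F' →
      ∀ ξ ξ' : ℕ → H, (∀ n, ‖ξ n‖ = 1) → (∀ n, ‖ξ' n‖ = 1) →
        CovariantPhase.IsGeneratedBy b ξ F → CovariantPhase.IsGeneratedBy b ξ' F' →
        (CovariantPhase.EquivalentObservables (CovariantPhase.numberShift b) F F' ↔
          ∃ z : ℕ → Circle, ∀ n m : ℕ,
            inner ℂ (ξ' n) (ξ' m) = inner ℂ ((z n : ℂ) • ξ n) ((z m : ℂ) • ξ m))) ∧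
    -- the isometry is not surjective, and no phase observable is projection valued
    ¬ Function.Surjective (CovariantPhase.numberToTorus b) ∧
    ¬ ∃ F : Set Circle → H →L[ℂ] H,
        CovariantPhase.IsPhaseObservable b F ∧ CovariantPhase.IsProjectionValued F := by 
  refine ⟨CovariantPhase.isPhaseObservable_iff_exists_compress b,
    CovariantPhase.isPhaseObservable_iff_exists_isGeneratedBy b,
    fun ξ hξ => CovariantPhase.exists_isPhaseObservable_isGeneratedBy b hξ,
    fun ξ η _ _ F G hF hG => hF.sameObservable_iff hG,
    fun F F' _ _ ξ ξ' _ _ hF hF' => hF.equivalentObservables_iff hF',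
    CovariantPhase.not_surjective_numberToTorus b, ?_⟩
  rintro ⟨F, hF, hproj⟩
  exact hF.not_isProjectionValued hproj
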